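/- Let $K\ge 4$, $L\ge 1$, $T\ge 1$ be integers. Consider the $K$-user interference channel over $L$ coherence periods of duration $T$ ($T=1$ is fast fading, general $T$ is block fading), with channel matrices $$\mathbf H_{ij}=\mathbf I_T\otimes \mathrm{diag}\bigl[h_{ij}^{(1)},\dots,h_{ij}^{(L)}\bigr]\in\mathbb R^{TL\times TL},\qquad i,j=1,\dots,K,$$ where the random coefficients $(h_{ij}^{(\ell)})_{1\le i,j\le K,\,1\le \ell\le L}$ have a joint density on $\mathbb R^{LK^2}$. For a realization of the coefficients let $$\mathrm{DoF}=\max \frac{KD}{TL},$$ where the maximum is over all integers $D\ge 0$ for which there are $D$-dimensional subspaces $V_1,\dots,V_K\subseteq\mathbb R^{TL}$ satisfying the decoding condition $\mathbf H_{ii}V_i\cap\sum_{j\ne i}\mathbf H_{ij}V_j=\{0\}$ for every $i=1,\dots,K$. Then, with probability $1$, $$\mathrm{DoF}\le \frac K2\left(1-2^{-17}\min\left\{\frac1{\sqrt[4]{L}},\ \frac{2^{(K-2)(K-3)/4}}{\sqrt L}\right\}\right).$$ Consequently, with probability $1$, for every real $C\ge 1$ with $L\le C\,2^{(K-2)(K-3)}$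 one has $\mathrm{DoF}\le \frac K2\bigl(1-2^{-17}C^{-1/4}L^{-1/4}\bigr)$; that is, as long as $L$ is at most of the order of $2^{(K-2)(K-3)}$, the gap to $1/2$ degrees of freedom per user decays no faster than $L^{-1/4}$. -/

import Mathlib

open MeasureTheory
open scoped Kronecker

/-- The channel matrix `H = I_T ⊗ diag(g 1, …, g L)` of one transmitter-receiver pair whose fading
coefficients over the `L` coherence periods (each of duration `T`) are `g`.  For `T = 1` this is
the fast fading channel `diag(g 1, …, g L)`. -/
def channelMatrix {L : ℕ} (T : ℕ) (g : Fin L → ℝ) :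
    Matrix (Fin T × Fin L) (Fin T × Fin L) ℝ :=
  (1 : Matrix (Fin T) (Fin T) ℝ) ⊗ₖ Matrix.diagonal g

/-- The image `H V = {H v : v ∈ V}` of a subspace `V` of the signal space `ℝ^{TL}`. -/
def receivedSpace {L : ℕ} (T : ℕ) (g : Fin L → ℝ) (V : Submodule ℝ (Fin T × Fin L → ℝ)) :
    Submodule ℝ (Fin T × Fin L → ℝ) :=
  V.map (Matrix.mulVecLin (channelMatrix T g))

/-- The decoding condition at receiver `i`, where `h i j` are the fading coefficients from
transmitter `j` to receiver `i` and `V j` is the signal space of transmitter `j`: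
`H_{ii} V_i ∩ ∑_{j ≠ i} H_{ij} V_j = {0}`. -/
def DecodingCondition {K L : ℕ} (T : ℕ) (h : Fin K → Fin K → Fin L → ℝ)
    (V : Fin K → Submodule ℝ (Fin T × Fin L → ℝ)) (i : Fin K) : Prop :=
  receivedSpace T (h i i) (V i) ⊓ (⨆ j : Fin K, ⨆ _ : j ≠ i, receivedSpace T (h i j) (V j)) = ⊥

/-- The values `KD/(TL)` for which every transmitter can be given a `D`-dimensional signal space
(the column span of a precoding matrix for `D` data symbols) such that the decoding condition
holds at every receiver. -/
def achievableDoF {K L : ℕ} (T : ℕ) (h : Fin K → Fin K → Fin L → ℝ) : Set ℝ :=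
  {d | ∃ (D : ℕ) (V : Fin K → Submodule ℝ (Fin T × Fin L → ℝ)),
    (∀ i, Module.finrank ℝ (V i) = D) ∧ (∀ i, DecodingCondition T h V i) ∧
    d = (K : ℝ) * (D : ℝ) / ((T : ℝ) * (L : ℝ))}

/-- The maximum total degrees of freedom achievable by vector space interference alignment for
the channel realization `h`. -/
noncomputable def maxDoF {K L : ℕ} (T : ℕ) (h : Fin K → Fin K → Fin L → ℝ) : ℝ :=
  sSup (achievableDoF T h)

/-- The supremum defining `maxDoF` is a maximum. -/
theorem isGreatest_maxDoF {K L : ℕ} (T : ℕ) (hK : 0 < K) (h : Fin K → Fin K → Fin L → ℝ) :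
    IsGreatest (achievableDoF T h) (maxDoF T h) := by
  have hne : (achievableDoF T h).Nonempty := by
    refine ⟨_, 0, fun _ => ⊥, fun i => finrank_bot ℝ _, fun i => ?_, rfl⟩
    simp [DecodingCondition, receivedSpace]
  have hfin : (achievableDoF T h).Finite := by
    refine ((Set.finite_Iic (T * L)).image
      (fun D : ℕ => (K : ℝ) * (D : ℝ) / ((T : ℝ) * (L : ℝ)))).subset ?_
    rintro d ⟨D, V, hV, -, rfl⟩
    refine ⟨D, ?_, rfl⟩
    have h1 := Submodule.finrank_le (V ⟨0, hK⟩)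
    rw [hV ⟨0, hK⟩] at h1
    simpa using h1
  exact ⟨hne.csSup_mem hfin, fun d hd => le_csSup hfin.bddAbove hd⟩

/-! ### Plünnecke–Petridis growth estimates for subspaces of a commutative algebra -/

section SubmoduleProducts

open Module Submodule
open scoped Pointwise

variable {k A : Type*} [Field k] [CommRing A] [Algebra k A]

/-! Four users suffice. Channels are units of the commutative algebra `ℝ^{TL}` (dimension `N`). With
`d = N - 2D` small, decodability makes interferers nearly aligned at each receiver. Following
alignments around a loop returns `V 0` nearly to itself, so `V 0` is nearly invariant under the
loop's channel ratio. This gives four nearly preserving multipliers (`loopNum / loopDen`).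

For generic coefficients, `L` monomials in these ratios with exponents below `k ≈ L^{1/4}` span all
multipliers constant over each coherence period (`mem_span_loops_pow`). Hence the multiplier `b`,
which turns alignment with user `1` at receiver `3` into that user's interference at receiver `0`,
lies in the `4k`-th power of the span `F` of `1` and the loops. Decodability at receiver `0` forces
`W ∩ bW = 0`, where `W ⊆ V 0` is the part aligned with user `1`.

A Petridis argument (`finrank_mul_span_mul_le`) bounds growth under `F ^ m` by the `m`-th power of
the growth under `F`. So `2 ≤ (1 + 10d / dim W) ^ (4k)`, and `d` is at least of order `D / k`. -/

theorem finrank_span_singleton_mul {c : A} (hc : IsUnit c) (X : Submodule k A) :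
    finrank k (span k {c} * X : Submodule k A) = finrank k X := by
  have h : (span k {c} * X : Submodule k A) = X.map (LinearMap.mulLeft k c) := by
    ext x
    simp [Submodule.mem_span_singleton_mul]
  rw [h]
  exact (Submodule.equivMapOfInjective _ hc.mul_right_injective X).finrank_eq.symm

theorem finrank_span_singleton_mul_sup {c : A} (hc : IsUnit c) (X Y : Submodule k A) :
    finrank k (span k {c} * X ⊔ span k {c} * Y : Submodule k A) =
      finrank k (X ⊔ Y : Submodule k A) := by
  rw [← Submodule.mul_sup, finrank_span_singleton_mul hc]

variable [FiniteDimensional k A]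

/-- Petridis' lemma for linear spans: the growth factor of a subspace `X` of minimal growth under
`F` is not exceeded by its translates. -/
theorem finrank_mul_span_mul_le {F X : Submodule k A} {p q : ℕ}
    (hX : ∀ Z ≤ X, q * finrank k (F * X : Submodule k A) + p * finrank k Z ≤
      q * finrank k (F * Z : Submodule k A) + p * finrank k X)
    {s : Set A} (hs : s.Finite) (hu : ∀ c ∈ s, IsUnit c) :
    q * finrank k (F * (span k s * X) : Submodule k A) ≤
      p * finrank k (span k s * X : Submodule k A) := by
  induction s, hs using Set.Finite.induction_on with
  | empty => rw [Submodule.span_empty, Submodule.bot_mul, Submodule.mul_bot, finrank_bot]; simp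
  | @insert c s _ _ ih =>
    have ih := ih fun c hc => hu c (Set.mem_insert_of_mem _ hc)
    have hc : IsUnit c := hu c (Set.mem_insert _ _)
    set W : Submodule k A := span k s * X with hW
    -- `Z` is the part of `X` whose translate by `c` adds nothing to `W`; submodularity and
    -- minimality of `X` against `Z` give the induction step.
    set Z : Submodule k A := X ⊓ W.comap (LinearMap.mulLeft k c) with hZ
    have hins : (span k (insert c s) * X : Submodule k A) = span k {c} * X ⊔ W := by
      rw [Submodule.span_insert, Submodule.sup_mul]
    have hcZ : span k {c} * Z = span k {c} * X ⊓ W := by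
      ext x
      simp only [Submodule.mem_span_singleton_mul, hZ, Submodule.mem_inf, Submodule.mem_comap,
        LinearMap.mulLeft_apply]
      constructor
      · rintro ⟨z, ⟨hz, hz'⟩, rfl⟩
        exact ⟨⟨z, hz, rfl⟩, hz'⟩
      · rintro ⟨⟨z, hz, rfl⟩, hz'⟩
        exact ⟨z, ⟨hz, hz'⟩, rfl⟩
    have hF : F * (span k {c} * X ⊔ W) = span k {c} * (F * X) ⊔ F * W := by
      rw [Submodule.mul_sup, mul_left_comm]
    have hle : span k {c} * (F * Z) ≤ span k {c} * (F * X) ⊓ F * W := by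
      refine le_inf (mul_le_mul' le_rfl (mul_le_mul' le_rfl inf_le_left)) ?_
      rw [mul_left_comm, hcZ]
      exact mul_le_mul' le_rfl inf_le_right
    have h1 := Submodule.finrank_sup_add_finrank_inf_eq (span k {c} * X) W
    have h2 := Submodule.finrank_sup_add_finrank_inf_eq (span k {c} * (F * X)) (F * W)
    have h3 := Submodule.finrank_mono hle
    rw [← hcZ] at h1
    rw [finrank_span_singleton_mul hc] at h1 h2 h3
    rw [finrank_span_singleton_mul hc] at h1
    have h4 := hX Z inf_le_left
    rw [hins, hF]
    have h5 : q * finrank k (span k {c} * (F * X) ⊔ F * W : Submodule k A) +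
        q * finrank k (F * Z : Submodule k A) ≤
        q * finrank k (F * X : Submodule k A) + q * finrank k (F * W : Submodule k A) := by
      rw [← mul_add, ← mul_add]
      exact Nat.mul_le_mul_left _ (by omega)
    have h6 : p * finrank k (span k {c} * X ⊔ W : Submodule k A) + p * finrank k Z =
        p * finrank k X + p * finrank k W := by
      rw [← mul_add, ← mul_add, h1]
    omega

theorem finrank_span_pow_mul_le {s : Set A} (hs : s.Finite) (hu : ∀ c ∈ s, IsUnit c)
    {X : Submodule k A} {p q : ℕ}
    (hX : ∀ Z ≤ X, q * finrank k (span k s * X : Submodule k A) + p * finrank k Z ≤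
      q * finrank k (span k s * Z : Submodule k A) + p * finrank k X) (m : ℕ) :
    q ^ m * finrank k (span k s ^ m * X : Submodule k A) ≤ p ^ m * finrank k X := by
  have hpow : ∀ m : ℕ, (s ^ m).Finite ∧ ∀ c ∈ s ^ m, IsUnit c := by
    intro m
    induction m with
    | zero => simp
    | succ m ih =>
      rw [pow_succ]
      refine ⟨ih.1.mul hs, ?_⟩
      rintro _ ⟨a, ha, b, hb, rfl⟩
      exact (ih.2 a ha).mul (hu b hb)
  induction m with
  | zero => rw [pow_zero, pow_zero, pow_zero, one_mul, one_mul, one_mul]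
  | succ m ih =>
    have h := finrank_mul_span_mul_le hX (hpow m).1 (hpow m).2
    rw [← Submodule.span_pow, ← mul_assoc, ← pow_succ'] at h
    calc q ^ (m + 1) * finrank k (span k s ^ (m + 1) * X : Submodule k A)
        = q ^ m * (q * finrank k (span k s ^ (m + 1) * X : Submodule k A)) := by ring
      _ ≤ q ^ m * (p * finrank k (span k s ^ m * X : Submodule k A)) := Nat.mul_le_mul_left _ h
      _ = p * (q ^ m * finrank k (span k s ^ m * X : Submodule k A)) := by ring
      _ ≤ p * (p ^ m * finrank k X) := Nat.mul_le_mul_left _ ih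
      _ = p ^ (m + 1) * finrank k X := by ring

/-- Minimise `q dim(FX) - p dim X` over nonzero `X ≤ V`, shifted by `p dim A` to stay in `ℕ`. The
hypothesis on `V` makes the minimum nonpositive, which covers `Z = ⊥`. -/
theorem exists_minimal_growth (F : Submodule k A) {V : Submodule k A} (hV : V ≠ ⊥) {p q : ℕ}
    (hpq : q * finrank k (F * V : Submodule k A) ≤ p * finrank k V) :
    ∃ X ≤ V, X ≠ ⊥ ∧ ∀ Z ≤ X, q * finrank k (F * X : Submodule k A) + p * finrank k Z ≤
      q * finrank k (F * Z : Submodule k A) + p * finrank k X := by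
  obtain ⟨X, ⟨hXV, hX0⟩, hmin⟩ := exists_minimalFor_of_wellFoundedLT
    (fun X : Submodule k A => X ≤ V ∧ X ≠ ⊥)
    (fun X => q * finrank k (F * X : Submodule k A) + p * (finrank k A - finrank k X))
    ⟨V, le_rfl, hV⟩
  have key : ∀ Z ≤ V, Z ≠ ⊥ → q * finrank k (F * X : Submodule k A) + p * finrank k Z ≤
      q * finrank k (F * Z : Submodule k A) + p * finrank k X := by
    intro Z hZV hZ
    have h : q * finrank k (F * X : Submodule k A) + p * (finrank k A - finrank k X) ≤
        q * finrank k (F * Z : Submodule k A) + p * (finrank k A - finrank k Z) := by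
      by_contra! hlt
      exact absurd (hmin ⟨hZV, hZ⟩ hlt.le) (not_le.2 hlt)
    have hadd : ∀ Y : Submodule k A,
        p * (finrank k A - finrank k Y) + p * finrank k Y = p * finrank k A := fun Y => by
      rw [← mul_add, Nat.sub_add_cancel (Submodule.finrank_le Y)]
    have := hadd X
    have := hadd Z
    omega
  refine ⟨X, hXV, hX0, fun Z hZ => ?_⟩
  rcases eq_or_ne Z ⊥ with rfl | hZ0
  · have := key V le_rfl hV
    rw [Submodule.mul_bot, finrank_bot]
    omega
  · exact key Z (hZ.trans hXV) hZ0

/-- If `V` grows at most by the factor `p / q` under `span s ∋ 1`, and some unit `b` in the `m`-th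
power of `span s` moves `V` to a subspace independent of `V`, then `(p / q) ^ m ≥ 2`. -/
theorem two_mul_pow_le_of_disjoint {s : Set A} (hs : s.Finite) (hu : ∀ c ∈ s, IsUnit c)
    (h1 : (1 : A) ∈ s) {V : Submodule k A} (hV : V ≠ ⊥) {p q : ℕ}
    (hpq : q * finrank k (span k s * V : Submodule k A) ≤ p * finrank k V) {m : ℕ} {b : A}
    (hb : IsUnit b) (hbm : b ∈ span k s ^ m) (hdisj : V ⊓ span k {b} * V = ⊥) :
    2 * q ^ m ≤ p ^ m := by
  obtain ⟨X, hXV, hX0, hX⟩ := exists_minimal_growth (span k s) hV hpq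
  have h := finrank_span_pow_mul_le hs hu hX m
  have hone : (1 : A) ∈ span k s ^ m := by
    simpa using Submodule.pow_mem_pow (span k s) (Submodule.subset_span h1) m
  have hle : X ⊔ span k {b} * X ≤ span k s ^ m * X := by
    refine sup_le (fun x hx => ?_) (mul_le_mul' ?_ le_rfl)
    · simpa using Submodule.mul_mem_mul hone hx
    · simpa using hbm
  have hbot : X ⊓ span k {b} * X = ⊥ :=
    eq_bot_iff.2 (hdisj ▸ inf_le_inf hXV (mul_le_mul' le_rfl hXV))
  have h2 := Submodule.finrank_sup_add_finrank_inf_eq X (span k {b} * X)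
  rw [hbot, finrank_bot, finrank_span_singleton_mul hb] at h2
  have h3 := Submodule.finrank_mono hle
  have hpos : 0 < finrank k X := Nat.pos_of_ne_zero fun h0 => hX0 (Submodule.finrank_eq_zero.1 h0)
  refine Nat.le_of_mul_le_mul_right ?_ hpos
  calc 2 * q ^ m * finrank k X = q ^ m * (finrank k X + finrank k X) := by ring
    _ ≤ q ^ m * finrank k (span k s ^ m * X : Submodule k A) :=
      Nat.mul_le_mul_left _ (by omega)
    _ ≤ p ^ m * finrank k X := h

/-- Submodularity, used as a triangle inequality to chain approximate alignments. -/
theorem finrank_sup_le_trans (U V W : Submodule k A) :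
    finrank k (U ⊔ W : Submodule k A) + finrank k V ≤
      finrank k (U ⊔ V : Submodule k A) + finrank k (V ⊔ W : Submodule k A) := by
  have h := Submodule.finrank_sup_add_finrank_inf_eq (U ⊔ V) (V ⊔ W)
  have h1 : finrank k (U ⊔ W : Submodule k A) ≤ finrank k (U ⊔ V ⊔ (V ⊔ W) : Submodule k A) :=
    Submodule.finrank_mono (sup_le_sup le_sup_left le_sup_right)
  have h2 : finrank k V ≤ finrank k ((U ⊔ V) ⊓ (V ⊔ W) : Submodule k A) :=
    Submodule.finrank_mono (le_inf le_sup_right le_sup_left)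
  omega

end SubmoduleProducts

/-! ### Zero sets of polynomial functions are null -/

section NullSets

open Polynomial

/-- In polar coordinates around `x₀`, each ray carries a nonzero polynomial, hence finitely many
zeros. -/
theorem ae_ne_zero_of_polynomial_on_lines {E : Type*} [NormedAddCommGroup E] [NormedSpace ℝ E]
    [FiniteDimensional ℝ E] [MeasurableSpace E] [BorelSpace E] (μ : Measure E)
    [μ.IsAddHaarMeasure] {f : E → ℝ} (hf : Continuous f)
    (hline : ∀ x v, ∃ p : ℝ[X], ∀ t : ℝ, f (x + t • v) = p.eval t) {x₀ : E} (h₀ : f x₀ ≠ 0) :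
    ∀ᵐ x ∂μ, f x ≠ 0 := by
  set S : Set E := {y | f (x₀ + y) = 0} with hS
  have hSm : MeasurableSet S :=
    (isClosed_singleton.preimage (hf.comp (continuous_const.add continuous_id))).measurableSet
  have hT : MeasurableSet {z : Metric.sphere (0 : E) 1 × Set.Ioi (0 : ℝ) |
      f (x₀ + (z.2 : ℝ) • (z.1 : E)) = 0} := by
    refine (isClosed_singleton.preimage (hf.comp ?_)).measurableSet
    fun_prop
  have hnull : μ S = 0 := by
    have hpre := (μ.measurePreserving_homeomorphUnitSphereProd).measure_preimage
      hT.nullMeasurableSet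
    rw [(Measure.measure_prod_null hT).2, comap_subtype_coe_apply (by measurability)] at hpre
    · refine measure_mono_null (fun y hy => ?_) hpre
      have hy0 : y ≠ 0 := by
        rintro rfl
        exact h₀ (by simpa [hS] using hy)
      refine ⟨⟨y, hy0⟩, ?_, rfl⟩
      have : ‖y‖ • ‖y‖⁻¹ • y = y := smul_inv_smul₀ (norm_ne_zero_iff.2 hy0) y
      simpa [hS, homeomorphUnitSphereProd, this] using hy
    · refine Filter.Eventually.of_forall fun v => ?_
      obtain ⟨p, hp⟩ := hline x₀ (v : E)
      have hp0 : p ≠ 0 := by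
        rintro rfl
        exact h₀ (by simpa using hp 0)
      refine withDensity_absolutelyContinuous _ _ ?_
      rw [comap_subtype_coe_apply measurableSet_Ioi]
      refine Set.Finite.measure_zero ((p.rootSet_finite ℝ).subset ?_) _
      rintro _ ⟨r, hr, rfl⟩
      have : p.eval (r : ℝ) = 0 := by rw [← hp]; exact hr
      simp [Polynomial.mem_rootSet, hp0, this]
  have hshift : μ ((fun y => -x₀ + y) ⁻¹' S) = 0 := by rwa [measure_preimage_add]
  rw [ae_iff]
  convert hshift using 2
  ext y
  simp [hS]

end NullSets

/-! ### Generic independence of the loop monomials -/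

section Genericity

open Polynomial

/-- Numerators of four alignment loops based at transmitter `0` of a four user channel. -/
def loopNum {R : Type*} [CommRing R] (H : Fin 4 → Fin 4 → R) : Fin 4 → R :=
  ![H 3 1 * H 2 0, H 3 2 * H 1 0, H 2 3 * H 1 0, H 2 1 * H 0 2 * H 1 0]

/-- Denominators of four alignment loops based at transmitter `0` of a four user channel. -/
def loopDen {R : Type*} [CommRing R] (H : Fin 4 → Fin 4 → R) : Fin 4 → R :=
  ![H 3 0 * H 2 1, H 3 0 * H 1 2, H 2 0 * H 1 3, H 2 0 * H 0 1 * H 1 2]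

/-- The values of the monomials in the four loop ratios, with exponents the base-`k` digits of the
column index and denominators cleared. -/
def loopMonomialMatrix {R : Type*} [CommRing R] {L : ℕ} (k : ℕ) (H : Fin L → Fin 4 → Fin 4 → R) :
    Matrix (Fin L) (Fin L) R :=
  Matrix.of fun l l' => ∏ s : Fin 4, loopNum (H l) s ^ ((l' : ℕ) / k ^ (s : ℕ) % k) *
    loopDen (H l) s ^ (k - (l' : ℕ) / k ^ (s : ℕ) % k)

theorem map_loopNum {R S : Type*} [CommRing R] [CommRing S] (φ : R →+* S)
    (H : Fin 4 → Fin 4 → R) (s : Fin 4) :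
    φ (loopNum H s) = loopNum (fun i j => φ (H i j)) s := by
  fin_cases s <;> simp [loopNum]

theorem map_loopDen {R S : Type*} [CommRing R] [CommRing S] (φ : R →+* S)
    (H : Fin 4 → Fin 4 → R) (s : Fin 4) :
    φ (loopDen H s) = loopDen (fun i j => φ (H i j)) s := by
  fin_cases s <;> simp [loopDen]

theorem map_det_loopMonomialMatrix {R S : Type*} [CommRing R] [CommRing S] (φ : R →+* S) {L : ℕ}
    (k : ℕ) (H : Fin L → Fin 4 → Fin 4 → R) :
    φ (loopMonomialMatrix k H).det =
      (loopMonomialMatrix k (fun l i j => φ (H l i j))).det := by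
  rw [RingHom.map_det]
  congr 1
  ext l l'
  simp [loopMonomialMatrix, map_loopNum, map_loopDen]

theorem continuous_loopNum (s : Fin 4) :
    Continuous fun H : Fin 4 → Fin 4 → ℝ => loopNum H s := by
  fin_cases s <;> simp only [loopNum] <;> simp <;> fun_prop

theorem continuous_loopDen (s : Fin 4) :
    Continuous fun H : Fin 4 → Fin 4 → ℝ => loopDen H s := by
  fin_cases s <;> simp only [loopDen] <;> simp <;> fun_prop

theorem continuous_det_loopMonomialMatrix {L : ℕ} (k : ℕ) :
    Continuous fun H : Fin L → Fin 4 → Fin 4 → ℝ => (loopMonomialMatrix k H).det := by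
  refine Continuous.matrix_det (continuous_matrix fun l l' => ?_)
  simp only [loopMonomialMatrix, Matrix.of_apply]
  exact continuous_finsetProd _ fun s _ =>
    (((continuous_loopNum s).comp (continuous_apply l)).pow _).mul
      (((continuous_loopDen s).comp (continuous_apply l)).pow _)

theorem sum_digits_four {k x : ℕ} (hx : x < k ^ 4) :
    ∑ s : Fin 4, k ^ (s : ℕ) * (x / k ^ (s : ℕ) % k) = x := by
  have hk : 0 < k := Nat.pos_of_ne_zero (by rintro rfl; simp at hx)
  have h3 : x / k ^ 3 % k = x / k ^ 3 := by
    refine Nat.mod_eq_of_lt ((Nat.div_lt_iff_lt_mul (by positivity)).2 ?_)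
    rwa [← pow_succ']
  have e1 := Nat.mod_add_div x k
  have e2 := Nat.mod_add_div (x / k) k
  have e3 := Nat.mod_add_div (x / k ^ 2) k
  rw [Nat.div_div_eq_div_mul, ← pow_two] at e2
  rw [Nat.div_div_eq_div_mul, ← pow_succ] at e3
  simp only [Fin.sum_univ_four, Fin.val_zero, Fin.val_one, Fin.val_two, pow_zero, pow_one,
    Nat.div_one, one_mul]
  change x % k + k * (x / k % k) + k ^ 2 * (x / k ^ 2 % k) + k ^ 3 * (x / k ^ 3 % k) = x
  rw [h3]
  calc x % k + k * (x / k % k) + k ^ 2 * (x / k ^ 2 % k) + k ^ 3 * (x / k ^ 3)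
      = x % k + k * (x / k % k + k * (x / k ^ 2 % k + k * (x / k ^ 3))) := by ring
    _ = x := by
      have : x / k ^ (2 + 1) = x / k ^ 3 := rfl
      rw [← this, e3, e2, e1]

theorem exists_det_loopMonomialMatrix_ne_zero {k L : ℕ} (hL : L ≤ k ^ 4) :
    ∃ W : Fin L → Fin 4 → Fin 4 → ℝ, (loopMonomialMatrix k W).det ≠ 0 := by
  -- Chosen so that the loop ratios are `l ^ k ^ s`; base-`k` digits then make column `l'` equal to
  -- `l ^ l'`, a Vandermonde matrix.
  let W : Fin L → Fin 4 → Fin 4 → ℝ := fun l =>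
    ![![1, 1, (l : ℝ) ^ k ^ 3, 1], ![1, 1, 1, 1], ![1, 1, 1, (l : ℝ) ^ k ^ 2],
      ![1, (l : ℝ), (l : ℝ) ^ k, 1]]
  have hnum : ∀ l s, loopNum (W l) s = (l : ℝ) ^ k ^ (s : ℕ) := by
    intro l s
    fin_cases s <;> simp [loopNum, W]
  have hden : ∀ l s, loopDen (W l) s = 1 := by
    intro l s
    fin_cases s <;> simp [loopDen, W]
  refine ⟨W, ?_⟩
  have : loopMonomialMatrix k W = Matrix.vandermonde fun l : Fin L => (l : ℝ) := by
    ext l l'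
    simp only [loopMonomialMatrix, Matrix.of_apply, Matrix.vandermonde_apply, hnum, hden, one_pow,
      mul_one, ← pow_mul]
    rw [Finset.prod_pow_eq_pow_sum, sum_digits_four (l'.2.trans_le hL)]
  rw [this, Matrix.det_vandermonde_ne_zero_iff]
  intro a b hab
  exact Fin.ext (Nat.cast_injective (R := ℝ) hab)

theorem isAddHaarMeasure_volume_pi_pi_pi (ι κ τ : Type*) [Fintype ι] [Fintype κ] [Fintype τ] :
    (volume : Measure (ι → κ → τ → ℝ)).IsAddHaarMeasure := by
  have : (volume : Measure (κ → τ → ℝ)).IsAddHaarMeasure :=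
    Measure.pi.isAddHaarMeasure fun _ : κ => (volume : Measure (τ → ℝ))
  exact Measure.pi.isAddHaarMeasure fun _ : ι => (volume : Measure (κ → τ → ℝ))

theorem ae_det_loopMonomialMatrix_ne_zero {K L k : ℕ} (hL : L ≤ k ^ 4) {e : Fin 4 → Fin K}
    (he : Function.Injective e) :
    ∀ᵐ h : Fin K → Fin K → Fin L → ℝ,
      (loopMonomialMatrix k fun l i j => h (e i) (e j) l).det ≠ 0 := by
  obtain ⟨W, hW⟩ := exists_det_loopMonomialMatrix_ne_zero hL
  have := isAddHaarMeasure_volume_pi_pi_pi (Fin K) (Fin K) (Fin L)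
  have hproj : Continuous fun (h : Fin K → Fin K → Fin L → ℝ) l i j => h (e i) (e j) l := by
    fun_prop
  have hcont := (continuous_det_loopMonomialMatrix (L := L) k).comp hproj
  refine ae_ne_zero_of_polynomial_on_lines volume
    (f := fun h : Fin K → Fin K → Fin L → ℝ =>
      (loopMonomialMatrix k fun l i j => h (e i) (e j) l).det)
    hcont
    (fun x v => ⟨(loopMonomialMatrix k fun l i j =>
      C (x (e i) (e j) l) + X * C (v (e i) (e j) l)).det, fun t => ?_⟩)
    (x₀ := fun i j l => W l (Function.invFun e i) (Function.invFun e j)) ?_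
  · rw [← coe_evalRingHom, map_det_loopMonomialMatrix]
    simp [mul_comm t]
  · simpa [Function.leftInverse_invFun he _] using hW

theorem ae_forall_coeff_ne_zero (K L : ℕ) :
    ∀ᵐ h : Fin K → Fin K → Fin L → ℝ, ∀ i j l, h i j l ≠ 0 := by
  simp only [ae_all_iff]
  intro i j l
  have := isAddHaarMeasure_volume_pi_pi_pi (Fin K) (Fin K) (Fin L)
  refine ae_ne_zero_of_polynomial_on_lines volume
    (f := fun h : Fin K → Fin K → Fin L → ℝ => h i j l) (by fun_prop)
    (fun x v => ⟨C (x i j l) + X * C (v i j l), fun t => by simp [mul_comm t]⟩)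
    (x₀ := fun _ _ _ => 1) one_ne_zero

end Genericity

/-! ### Alignment loops and the four-user dimension bound -/

section FourUsers

open Module Submodule

variable {A : Type*} [CommRing A] [Algebra ℝ A]

/-- The desired signal takes `D` dimensions disjoint from the interference, leaving only `N - D` for
the latter. -/
theorem finrank_le_of_aligned [FiniteDimensional ℝ A] {D N : ℕ} {x y z : A} (hx : IsUnit x)
    {V W U : Submodule ℝ A} (hU : finrank ℝ U = D) (hN : finrank ℝ A = N)
    (h : span ℝ {x} * U ⊓ (span ℝ {y} * V ⊔ span ℝ {z} * W) = ⊥) :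
    finrank ℝ (span ℝ {y} * V ⊔ span ℝ {z} * W : Submodule ℝ A) + D ≤ N := by
  have h1 := Submodule.finrank_sup_add_finrank_inf_eq (span ℝ {x} * U)
    (span ℝ {y} * V ⊔ span ℝ {z} * W)
  rw [h, finrank_bot, finrank_span_singleton_mul hx, hU] at h1
  have h2 := Submodule.finrank_le (span ℝ {x} * U ⊔ (span ℝ {y} * V ⊔ span ℝ {z} * W))
  omega

theorem span_singleton_mul_mul (a b : A) (V : Submodule ℝ A) :
    span ℝ {a} * (span ℝ {b} * V) = span ℝ {a * b} * V := by
  rw [← mul_assoc, Submodule.span_mul_span, Set.singleton_mul_singleton]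

theorem span_singleton_one_mul (V : Submodule ℝ A) : span ℝ {(1 : A)} * V = V := by
  rw [← Submodule.one_eq_span, one_mul]

/-- If `y V + z W` is small, then so is `w V + w y⁻¹ z W`. -/
theorem finrank_sup_rescale {w y z z' : A} (hw : IsUnit w) (hy : IsUnit y) (hz : y * z' = w * z)
    (V W : Submodule ℝ A) :
    finrank ℝ (span ℝ {w} * V ⊔ span ℝ {z'} * W : Submodule ℝ A) =
      finrank ℝ (span ℝ {y} * V ⊔ span ℝ {z} * W : Submodule ℝ A) := by
  rw [← finrank_span_singleton_mul_sup hy, ← finrank_span_singleton_mul_sup hw (span ℝ {y} * V)]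
  rw [span_singleton_mul_mul, span_singleton_mul_mul, span_singleton_mul_mul,
    span_singleton_mul_mul, hz, mul_comm w y]

/-- Four users with `D`-dimensional signal spaces `V j` in a commutative algebra `A` of dimension
`N`, the channels `u i j` acting by multiplication. If the four alignment loops `a s` based at user
`0` generate the element `b` in the `m`-th power of their span, where `b` carries `V 0`, up to
alignment, to the interference seen by receiver `0`, then `D` is bounded away from `N / 2`. -/
theorem dimension_bound_of_loops [FiniteDimensional ℝ A] {u : Fin 4 → Fin 4 → A}
    (hu : ∀ i j, IsUnit (u i j)) {a : Fin 4 → A} (hau : ∀ s, IsUnit (a s))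
    (ha : ∀ s, loopDen u s * a s = loopNum u s)
    {V : Fin 4 → Submodule ℝ A} {D N : ℕ} (hV : ∀ j, finrank ℝ (V j) = D)
    (hN : finrank ℝ A = N)
    (hdec : ∀ i j l, j ≠ i → l ≠ i →
      span ℝ {u i i} * V i ⊓ (span ℝ {u i j} * V j ⊔ span ℝ {u i l} * V l) = ⊥)
    {m : ℕ} (hm : 1 ≤ m) {b : A} (hbu : IsUnit b)
    (hb : u 0 0 * u 3 1 * b = u 0 1 * u 3 0)
    (hbm : b ∈ span ℝ (insert 1 (Set.range a)) ^ m) :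
    D * (1 + 42 * m) ≤ 21 * m * N := by
  have hal : ∀ i j l, j ≠ i → l ≠ i →
      finrank ℝ (span ℝ {u i j} * V j ⊔ span ℝ {u i l} * V l : Submodule ℝ A) + D ≤ N :=
    fun i j l hj hl => finrank_le_of_aligned (hu i i) (hV i) hN (hdec i j l hj hl)
  -- one step of a loop
  have hstep : ∀ i j l, j ≠ i → l ≠ i → ∀ w z : A, IsUnit w → u i j * z = w * u i l →
      finrank ℝ (span ℝ {w} * V j ⊔ span ℝ {z} * V l : Submodule ℝ A) + D ≤ N := by
    intro i j l hj hl w z hw hz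
    rw [finrank_sup_rescale hw (hu i j) hz]
    exact hal i j l hj hl
  have hVs : ∀ (w : A) j, IsUnit w → finrank ℝ (span ℝ {w} * V j : Submodule ℝ A) = D :=
    fun w j hw => by rw [finrank_span_singleton_mul hw, hV]
  have hND : 2 * D ≤ N := by
    have h := hal 0 1 1 (by decide) (by decide)
    rw [sup_idem, hVs _ _ (hu 0 1)] at h
    omega
  have hinv : ∀ i j l, ∃ r, IsUnit r ∧ u i j * r = u i l := by
    intro i j l
    refine ⟨(hu i j).unit⁻¹ * u i l, (Units.isUnit _).mul (hu i l), ?_⟩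
    rw [← mul_assoc, IsUnit.mul_val_inv, one_mul]
  -- a loop through two receivers
  have hloop2 : ∀ i i' j, i ≠ 0 → i' ≠ 0 → j ≠ i → j ≠ i' → ∀ c : A,
      u i 0 * u i' j * c = u i j * u i' 0 →
      finrank ℝ (V 0 ⊔ span ℝ {c} * V 0 : Submodule ℝ A) + 3 * D ≤ 2 * N := by
    intro i i' j hi hi' hji hji' c hc
    obtain ⟨r, hr, hr'⟩ := hinv i 0 j
    have h1 := hstep i 0 j hi.symm hji 1 r isUnit_one (by rw [hr', one_mul])
    have h2 := hstep i' j 0 hji' hi'.symm r c hr ((hu i 0).mul_left_cancel (by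
      rw [← mul_assoc, hc, ← hr']; ring))
    have h3 := finrank_sup_le_trans (span ℝ {(1 : A)} * V 0) (span ℝ {r} * V j)
      (span ℝ {c} * V 0)
    rw [hVs _ _ hr] at h3
    rw [span_singleton_one_mul] at h1 h3
    omega
  have hloop3 : finrank ℝ (V 0 ⊔ span ℝ {a 3} * V 0 : Submodule ℝ A) + 5 * D ≤ 3 * N := by
    have hc : u 2 0 * u 0 1 * u 1 2 * a 3 = u 2 1 * u 0 2 * u 1 0 := ha 3
    obtain ⟨r, hr, hr'⟩ := hinv 2 0 1
    obtain ⟨t, ht, ht'⟩ := hinv 0 1 2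
    have h1 := hstep 2 0 1 (by decide) (by decide) 1 r isUnit_one (by rw [hr', one_mul])
    have h2 := hstep 0 1 2 (by decide) (by decide) r (r * t) hr (by rw [← ht']; ring)
    have h3 := hstep 1 2 0 (by decide) (by decide) (r * t) (a 3) (hr.mul ht)
      (((hu 2 0).mul (hu 0 1)).mul_left_cancel (by
        rw [← mul_assoc, hc, ← hr', ← ht']; ring))
    have h4 := finrank_sup_le_trans (span ℝ {(1 : A)} * V 0) (span ℝ {r} * V 1)
      (span ℝ {r * t} * V 2)
    have h5 := finrank_sup_le_trans (span ℝ {(1 : A)} * V 0) (span ℝ {r * t} * V 2)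
      (span ℝ {a 3} * V 0)
    rw [hVs _ _ hr] at h4
    rw [hVs _ _ (hr.mul ht)] at h5
    rw [span_singleton_one_mul] at h1 h4 h5
    omega
  have hl0 := hloop2 3 2 1 (by decide) (by decide) (by decide) (by decide) (a 0) (ha 0)
  have hl1 := hloop2 3 1 2 (by decide) (by decide) (by decide) (by decide) (a 1) (ha 1)
  have hl2 := hloop2 2 1 3 (by decide) (by decide) (by decide) (by decide) (a 2) (ha 2)
  -- the part of `V 0` that is aligned with `V 1` at receiver `3`
  obtain ⟨c, hcu, hc⟩ := hinv 3 0 1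
  set W : Submodule ℝ A := V 0 ⊓ span ℝ {c} * V 1 with hW
  have hWdim : 3 * D ≤ finrank ℝ W + N := by
    have h1 := hstep 3 0 1 (by decide) (by decide) 1 c isUnit_one (by rw [hc, one_mul])
    rw [span_singleton_one_mul] at h1
    have h2 := Submodule.finrank_sup_add_finrank_inf_eq (V 0) (span ℝ {c} * V 1)
    rw [← hW, hVs _ _ hcu, hV] at h2
    omega
  have hWdisj : W ⊓ span ℝ {b} * W = ⊥ := by
    have h1 : span ℝ {u 0 0} * (W ⊓ span ℝ {b} * W) ≤ ⊥ := by
      rw [← hdec 0 1 1 (by decide) (by decide), sup_idem]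
      refine le_inf (mul_le_mul' le_rfl (inf_le_left.trans inf_le_left)) ?_
      calc span ℝ {u 0 0} * (W ⊓ span ℝ {b} * W)
          ≤ span ℝ {u 0 0} * (span ℝ {b} * (span ℝ {c} * V 1)) :=
            mul_le_mul' le_rfl (inf_le_right.trans (mul_le_mul' le_rfl inf_le_right))
        _ = span ℝ {u 0 1} * V 1 := by
            rw [span_singleton_mul_mul, span_singleton_mul_mul]
            congr 3
            refine (hu 3 0).mul_left_cancel ?_
            rw [mul_comm (u 3 0) (u 0 1), ← hb, ← hc]
            ring
    have h2 := Submodule.finrank_mono h1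
    rw [finrank_span_singleton_mul (hu 0 0), finrank_bot] at h2
    exact Submodule.finrank_eq_zero.1 (Nat.le_zero.1 h2)
  -- With `d = N - 2D`, the loops enlarge `V 0` by at most `2d + 2d + 2d + 3d`, and passing from `V
  -- 0` to `W` costs one more `d`.
  have hgrow : finrank ℝ (span ℝ (insert 1 (Set.range a)) * W : Submodule ℝ A) + 20 * D ≤
      10 * N + finrank ℝ W := by
    have hle : span ℝ (insert 1 (Set.range a)) * W ≤
        (((span ℝ {a 0} * V 0 ⊔ V 0) ⊔ span ℝ {a 1} * V 0) ⊔ span ℝ {a 2} * V 0) ⊔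
          span ℝ {a 3} * V 0 := by
      refine (mul_le_mul' le_rfl inf_le_left : _ ≤ span ℝ (insert 1 (Set.range a)) * V 0).trans ?_
      refine Submodule.mul_le.2 fun x hx y hy => ?_
      refine Submodule.span_induction (p := fun x _ => x * y ∈ _) ?_ (by simp)
        (fun _ _ _ _ h1 h2 => by rw [add_mul]; exact add_mem h1 h2)
        (fun r _ _ h1 => by rw [smul_mul_assoc]; exact Submodule.smul_mem _ r h1) hx
      have hmem : ∀ s, a s * y ∈ span ℝ {a s} * V 0 := fun s =>
        Submodule.mul_mem_mul (Submodule.mem_span_singleton_self _) hy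
      rintro _ (rfl | ⟨s, rfl⟩)
      · rw [one_mul]
        exact mem_sup_left (mem_sup_left (mem_sup_left (mem_sup_right hy)))
      · fin_cases s
        · exact mem_sup_left (mem_sup_left (mem_sup_left (mem_sup_left (hmem 0))))
        · exact mem_sup_left (mem_sup_left (mem_sup_right (hmem 1)))
        · exact mem_sup_left (mem_sup_right (hmem 2))
        · exact mem_sup_right (hmem 3)
    have hadd : ∀ U X : Submodule ℝ A, V 0 ≤ U → finrank ℝ (U ⊔ X : Submodule ℝ A) + D ≤
        finrank ℝ U + finrank ℝ (V 0 ⊔ X : Submodule ℝ A) := by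
      intro U X hU
      have h := finrank_sup_le_trans U (V 0) X
      rwa [sup_eq_left.2 hU, hV] at h
    have h1 := hadd (span ℝ {a 0} * V 0 ⊔ V 0) (span ℝ {a 1} * V 0) le_sup_right
    have h2 := hadd (span ℝ {a 0} * V 0 ⊔ V 0 ⊔ span ℝ {a 1} * V 0) (span ℝ {a 2} * V 0)
      (le_sup_of_le_left le_sup_right)
    have h3 := hadd (span ℝ {a 0} * V 0 ⊔ V 0 ⊔ span ℝ {a 1} * V 0 ⊔ span ℝ {a 2} * V 0)
      (span ℝ {a 3} * V 0) (le_sup_of_le_left (le_sup_of_le_left le_sup_right))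
    have h4 := Submodule.finrank_mono hle
    rw [sup_comm (V 0)] at hl0
    omega
  rcases eq_or_ne W ⊥ with hW0 | hW0
  · rw [hW0, finrank_bot] at hWdim
    nlinarith
  obtain ⟨d, hd⟩ := Nat.exists_eq_add_of_le hND
  set D' := finrank ℝ W with hD'
  have hDpos : 0 < D' := Nat.pos_of_ne_zero fun h0 => hW0 (Submodule.finrank_eq_zero.1 h0)
  have hpow : 2 * D' ^ m ≤ (D' + 10 * d) ^ m := by
    refine two_mul_pow_le_of_disjoint (s := insert 1 (Set.range a)) ((Set.finite_range a).insert 1)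
      ?_ (Set.mem_insert _ _) hW0 ?_ hbu hbm hWdisj
    · rintro _ (rfl | ⟨s, rfl⟩)
      exacts [isUnit_one, hau s]
    · rw [mul_comm]
      exact Nat.mul_le_mul_right _ (by omega)
  -- Otherwise `10md / D' < 1/2`, and the growth is at most `exp (1/2) < 2`.
  have hkey : D' ≤ 20 * m * d := by
    by_contra! hlt
    have hD0 : (0 : ℝ) < D' := by exact_mod_cast hDpos
    have h1 : (2 : ℝ) * D' ^ m ≤ (D' + 10 * d) ^ m := by exact_mod_cast hpow
    have h2 : (D' + 10 * d : ℝ) = D' * (1 + 10 * d / D') := by field_simp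
    rw [h2, mul_pow, mul_comm (2 : ℝ)] at h1
    have h3 : (2 : ℝ) ≤ (1 + 10 * d / D') ^ m := le_of_mul_le_mul_left h1 (by positivity)
    have h4 : (1 + 10 * d / D' : ℝ) ^ m ≤ Real.exp (1 / 2) := by
      calc (1 + 10 * d / D' : ℝ) ^ m ≤ Real.exp (10 * d / D') ^ m := by
            gcongr
            rw [add_comm]
            exact Real.add_one_le_exp _
        _ = Real.exp (m * (10 * d / D')) := by rw [← Real.exp_nat_mul]
        _ ≤ Real.exp (1 / 2) := by
            refine Real.exp_le_exp.2 ?_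
            rw [mul_div_assoc', div_le_div_iff₀ hD0 two_pos]
            have : (20 * m * d : ℝ) < D' := by exact_mod_cast hlt
            linarith
    have h5 : Real.exp (1 / 2) < 2 := by
      have h6 : Real.exp (1 / 2) ^ 2 = Real.exp 1 := by
        rw [← Real.exp_nat_mul]; norm_num
      have h7 := Real.exp_one_lt_d9
      by_contra! h8
      nlinarith
    linarith
  have : D ≤ 21 * m * d := by nlinarith
  subst hd
  nlinarith

end FourUsers

/-! ### Application to the fading channel -/

section Channel

open Module Submodule

variable {K L T : ℕ}

theorem channelMatrix_mulVec (g : Fin L → ℝ) (v : Fin T × Fin L → ℝ) :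
    (channelMatrix T g).mulVec v = (fun p => g p.2) * v := by
  ext p
  rw [channelMatrix, ← Matrix.diagonal_one, Matrix.diagonal_kronecker_diagonal,
    Matrix.mulVec_diagonal]
  simp

theorem receivedSpace_eq_mul (g : Fin L → ℝ) (V : Submodule ℝ (Fin T × Fin L → ℝ)) :
    receivedSpace T g V = span ℝ {fun p : Fin T × Fin L => g p.2} * V := by
  ext x
  simp [receivedSpace, Submodule.mem_span_singleton_mul, channelMatrix_mulVec]

theorem mem_span_loops_pow {k : ℕ} (hL : L ≤ k ^ 4) {H : Fin L → Fin 4 → Fin 4 → ℝ}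
    (hden : ∀ l s, loopDen (H l) s ≠ 0) (hdet : (loopMonomialMatrix k H).det ≠ 0)
    (g : Fin L → ℝ) :
    (fun p : Fin T × Fin L => g p.2) ∈ span ℝ (insert (1 : Fin T × Fin L → ℝ)
      (Set.range fun s p => loopNum (H p.2) s / loopDen (H p.2) s)) ^ (4 * k) := by
  set a : Fin 4 → Fin T × Fin L → ℝ := fun s p => loopNum (H p.2) s / loopDen (H p.2) s with ha
  set F : Submodule ℝ (Fin T × Fin L → ℝ) := span ℝ (insert 1 (Set.range a)) with hF
  have hone : 1 ≤ F := by
    rw [Submodule.one_le]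
    exact subset_span (Set.mem_insert _ _)
  -- Interpolate `g` by loop monomials: clearing denominators multiplies row `l` by `∏ s, loopDen (H
  -- l) s ^ k`.
  obtain ⟨c, hc⟩ := (Matrix.mulVec_surjective_iff_isUnit.2
    ((Matrix.isUnit_iff_isUnit_det _).2 hdet.isUnit)) fun l => g l * ∏ s, loopDen (H l) s ^ k
  have hdig : ∀ (l' : Fin L) (s : Fin 4), (l' : ℕ) / k ^ (s : ℕ) % k ≤ k := fun l' s => by
    refine (Nat.mod_lt _ (Nat.pos_of_ne_zero ?_)).le
    rintro rfl
    have := l'.2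
    omega
  have hg : (fun p : Fin T × Fin L => g p.2) =
      ∑ l', c l' • ∏ s, a s ^ ((l' : ℕ) / k ^ (s : ℕ) % k) := by
    ext p
    have h1 := congrFun hc p.2
    have hprod : (∏ s, loopDen (H p.2) s ^ k) ≠ 0 :=
      Finset.prod_ne_zero_iff.2 fun s _ => pow_ne_zero _ (hden _ s)
    refine mul_right_cancel₀ hprod ?_
    rw [← h1, Finset.sum_apply, Finset.sum_mul, Matrix.mulVec, dotProduct]
    refine Finset.sum_congr rfl fun l' _ => ?_
    rw [Pi.smul_apply, Finset.prod_apply, smul_eq_mul, mul_assoc, ← Finset.prod_mul_distrib,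
      mul_comm]
    congr 1
    rw [loopMonomialMatrix, Matrix.of_apply]
    refine Finset.prod_congr rfl fun s _ => ?_
    rw [Pi.pow_apply, ha, div_pow]
    have hd := pow_ne_zero ((l' : ℕ) / k ^ (s : ℕ) % k) (hden p.2 s)
    rw [div_mul_eq_mul_div, eq_div_iff hd, mul_assoc, ← pow_add, Nat.sub_add_cancel (hdig l' s)]
  rw [hg]
  refine sum_mem fun l' _ => Submodule.smul_mem _ _ ?_
  have hmem : ∀ s, a s ^ ((l' : ℕ) / k ^ (s : ℕ) % k) ∈ F ^ k := fun s =>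
    pow_le_pow_right' hone (hdig l' s)
      (Submodule.pow_mem_pow F (subset_span (Set.mem_insert_of_mem _ (Set.mem_range_self s))) _)
  rw [Fin.prod_univ_four, show 4 * k = k + k + k + k by ring, pow_add, pow_add, pow_add]
  exact mul_mem_mul (mul_mem_mul (mul_mem_mul (hmem 0) (hmem 1)) (hmem 2)) (hmem 3)

theorem signal_dimension_bound {k : ℕ} (hk : 1 ≤ k) (hL : L ≤ k ^ 4) {e : Fin 4 → Fin K}
    (he : Function.Injective e) {h : Fin K → Fin K → Fin L → ℝ} (h0 : ∀ i j l, h i j l ≠ 0)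
    (hdet : (loopMonomialMatrix k fun l i j => h (e i) (e j) l).det ≠ 0) {D : ℕ}
    {V : Fin K → Submodule ℝ (Fin T × Fin L → ℝ)} (hV : ∀ i, finrank ℝ (V i) = D)
    (hdec : ∀ i, DecodingCondition T h V i) :
    D * (1 + 42 * (4 * k)) ≤ 21 * (4 * k) * (T * L) := by
  set H : Fin L → Fin 4 → Fin 4 → ℝ := fun l i j => h (e i) (e j) l with hH
  have hden : ∀ l s, loopDen (H l) s ≠ 0 := by
    intro l s
    fin_cases s <;> simp [loopDen, H, h0]
  have hnum : ∀ l s, loopNum (H l) s ≠ 0 := by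
    intro l s
    fin_cases s <;> simp [loopNum, H, h0]
  have hunit : ∀ x : Fin T × Fin L → ℝ, (∀ p, x p ≠ 0) → IsUnit x := fun x hx =>
    Pi.isUnit_iff.2 fun p => (hx p).isUnit
  let g : Fin L → ℝ := fun l => H l 0 1 * H l 3 0 / (H l 0 0 * H l 3 1)
  refine dimension_bound_of_loops (A := Fin T × Fin L → ℝ)
    (u := fun i j p => h (e i) (e j) p.2)
    (a := fun s p => loopNum (H p.2) s / loopDen (H p.2) s)
    (V := fun j => V (e j)) (b := fun p => g p.2)
    (fun i j => hunit _ fun p => h0 _ _ _)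
    (fun s => hunit _ fun p => div_ne_zero (hnum _ _) (hden _ _)) ?_ (fun j => hV _) (by simp)
    ?_ (by omega) ?_ ?_ (mem_span_loops_pow hL hden hdet g)
  · intro s
    ext p
    have e1 := map_loopDen (Pi.evalRingHom (fun _ : Fin T × Fin L => ℝ) p)
      (fun i j p => h (e i) (e j) p.2) s
    have e2 := map_loopNum (Pi.evalRingHom (fun _ : Fin T × Fin L => ℝ) p)
      (fun i j p => h (e i) (e j) p.2) s
    simp only [Pi.evalRingHom_apply] at e1 e2
    rw [Pi.mul_apply, e1, e2]
    exact mul_div_cancel₀ _ (hden p.2 s)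
  · intro i j l hj hl
    have hd := hdec (e i)
    rw [DecodingCondition] at hd
    refine eq_bot_iff.2 (le_trans ?_ hd.le)
    simp only [← receivedSpace_eq_mul]
    exact inf_le_inf le_rfl (sup_le
      (le_iSup₂_of_le (e j) (fun h => hj (he h)) le_rfl)
      (le_iSup₂_of_le (e l) (fun h => hl (he h)) le_rfl))
  · exact hunit _ fun p => by simp [g, H, h0]
  · ext p
    have h1 := h0 (e 0) (e 0) p.2
    have h2 := h0 (e 3) (e 1) p.2
    simp only [Pi.mul_apply, g, H]
    field_simp

theorem maxDoF_le_of_generic {k : ℕ} (hT : 1 ≤ T) (hL1 : 1 ≤ L) (hL : L ≤ k ^ 4)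
    (hkL : (k : ℝ) ≤ 2 * (L : ℝ) ^ ((1 : ℝ) / 4)) {e : Fin 4 → Fin K}
    (he : Function.Injective e) {h : Fin K → Fin K → Fin L → ℝ} (h0 : ∀ i j l, h i j l ≠ 0)
    (hdet : (loopMonomialMatrix k fun l i j => h (e i) (e j) l).det ≠ 0) :
    maxDoF T h ≤ (K : ℝ) / 2 * (1 - 1 / 2 ^ 17 * (1 / (L : ℝ) ^ ((1 : ℝ) / 4))) := by
  have hK : 0 < K := (Nat.zero_le _).trans_lt (e 0).2
  have hk : 1 ≤ k := Nat.pos_of_ne_zero (by rintro rfl; simp at hL; omega)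
  obtain ⟨D, V, hV, hdec, hD⟩ := (isGreatest_maxDoF T hK h).1
  have hbound := signal_dimension_bound hk hL he h0 hdet hV hdec
  have hbound' : (D : ℝ) * (1 + 42 * (4 * k)) ≤ 21 * (4 * k) * (T * L) := by
    exact_mod_cast hbound
  have hL' : (1 : ℝ) ≤ L := by exact_mod_cast hL1
  have hT' : (1 : ℝ) ≤ T := by exact_mod_cast hT
  set x : ℝ := (L : ℝ) ^ ((1 : ℝ) / 4)
  have hx : 1 ≤ x := Real.one_le_rpow hL' (by norm_num)
  have hN : (0 : ℝ) < T * L := by positivity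
  have hden : (0 : ℝ) < 1 + 42 * (4 * k) := by positivity
  have h1 : (D : ℝ) / (T * L) ≤ 1 / 2 * (1 - 1 / (1 + 42 * (4 * k))) := by
    rw [div_le_iff₀ hN]
    have : (1 : ℝ) / 2 * (1 - 1 / (1 + 42 * (4 * k))) * (T * L) =
        21 * (4 * k) * (T * L) / (1 + 42 * (4 * k)) := by
      field_simp
      ring
    rw [this, le_div_iff₀ hden]
    exact hbound'
  -- Since `k ≤ 2x` and `1 ≤ x`, the denominator is at most `337x`, far below `2 ^ 17 * x`.
  have h2 : 1 / 2 ^ 17 * (1 / x) ≤ 1 / (1 + 42 * (4 * k)) := by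
    rw [div_mul_div_comm, one_mul]
    exact one_div_le_one_div_of_le hden (by linarith)
  rw [hD]
  calc (K : ℝ) * D / (T * L) = K * (D / (T * L)) := mul_div_assoc _ _ _
    _ ≤ K * (1 / 2 * (1 - 1 / 2 ^ 17 * (1 / x))) := by
      gcongr
      linarith
    _ = K / 2 * (1 - 1 / 2 ^ 17 * (1 / x)) := by ring

end Channel

/-! ### Transfer to random coefficients -/

theorem theorem3 {Ω : Type*} [MeasurableSpace Ω] (P : Measure Ω) [IsProbabilityMeasure P]
    (K L T : ℕ) (hK : 4 ≤ K) (hL : 1 ≤ L) (hT : 1 ≤ T)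
    (h : Ω → Fin K → Fin K → Fin L → ℝ) (hpdf : HasPDF h P volume) :
    ∀ᵐ ω ∂P,
      maxDoF T (h ω) ≤ (K : ℝ) / 2 * (1 - 1 / 2 ^ 17 *
        min (1 / (L : ℝ) ^ ((1 : ℝ) / 4))
          ((2 : ℝ) ^ (((K : ℝ) - 2) * ((K : ℝ) - 3) / 4) / √(L : ℝ))) ∧
      ∀ C : ℝ, 1 ≤ C → (L : ℝ) ≤ C * 2 ^ ((K - 2) * (K - 3)) →
        maxDoF T (h ω) ≤ (K : ℝ) / 2 * (1 - 1 / 2 ^ 17 *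
          (1 / (C ^ ((1 : ℝ) / 4) * (L : ℝ) ^ ((1 : ℝ) / 4)))) := by
  have hL' : (1 : ℝ) ≤ L := by exact_mod_cast hL
  set x : ℝ := (L : ℝ) ^ ((1 : ℝ) / 4) with hxdef
  have hx : 1 ≤ x := Real.one_le_rpow hL' (by norm_num)
  have hx4 : x ^ 4 = L := by
    rw [hxdef, ← Real.rpow_natCast, ← Real.rpow_mul (by positivity)]
    norm_num
  have hLk : L ≤ ⌈x⌉₊ ^ 4 := by
    have : (L : ℝ) ≤ (⌈x⌉₊ : ℝ) ^ 4 := by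
      rw [← hx4]
      gcongr
      exact Nat.le_ceil x
    exact_mod_cast this
  have hkx : (⌈x⌉₊ : ℝ) ≤ 2 * x := by
    have := (Nat.ceil_lt_add_one (by linarith : 0 ≤ x)).le
    linarith
  have hgen : ∀ᵐ g : Fin K → Fin K → Fin L → ℝ, (∀ i j l, g i j l ≠ 0) ∧
      (loopMonomialMatrix ⌈x⌉₊ fun l i j => g (Fin.castLE hK i) (Fin.castLE hK j) l).det ≠ 0 :=
    (ae_forall_coeff_ne_zero K L).and
      (ae_det_loopMonomialMatrix_ne_zero hLk (Fin.castLE_injective hK))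
  have hmap := (HasPDF.absolutelyContinuous (X := h) (ℙ := P) (μ := volume)).ae_le hgen
  filter_upwards [ae_of_ae_map (HasPDF.aemeasurable h P volume) hmap] with ω hω
  have hmain := maxDoF_le_of_generic hT hL hLk hkx (Fin.castLE_injective hK) hω.1 hω.2
  -- Both conclusions weaken the bound with gap `2 ^ (-17) / x`: the minimum is at most `1 / x`, and
  -- `C ^ (1/4) ≥ 1`.
  have hweaken : ∀ δ : ℝ, δ ≤ 1 / x → maxDoF T (h ω) ≤ (K : ℝ) / 2 * (1 - 1 / 2 ^ 17 * δ) := by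
    intro δ hδ
    refine hmain.trans ?_
    gcongr
  refine ⟨hweaken _ (min_le_left _ _), fun C hC _ => hweaken _ ?_⟩
  have hC' : 1 ≤ C ^ ((1 : ℝ) / 4) := Real.one_le_rpow hC (by norm_num)
  exact one_div_le_one_div_of_le (by linarith) (le_mul_of_one_le_left (by linarith) hC')
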